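/- Let $X$ be a Banach space over $\mathbb{K}=\mathbb{R}$ or $\mathbb{C}$. A sequence $(x_n)$ in $X$ is basic if it is a Schauder basis of its closed linear span $[(x_n)]$, and seminormalized if $0<\inf_n\|x_n\|\le\sup_n\|x_n\|<\infty$. The sequence $(x_n)$ dominates $(y_n)$ if there is a constant $C$ such that $\|\sum a_i y_i\|\le C\|\sum a_i x_i\|$ for all finitely supported scalar sequences $(a_i)$. For a closed subspace $Y\subseteq X$, let $\mathcal{L}(Y,X)$ and $\mathcal{K}(Y,X)$ be the sets of bounded, respectively compact, linear operators from $Y$ to $X$, and let $i_{Y\to X}$ be the inclusion map. The following are equivalent. (A) There exist a basic sequence $(x_n)$ in $X$ and an operator $T\in\mathcal{L}([(x_n)],X)$ such that $T\notin\mathbb{K}\, i_{[(x_n)]\to X}+\mathcal{K}([(x_n)],X)$. (B) There exist a seminormalized basic sequence $(x_n)$ in $X$ and a sequence $(y_n)$ in $X$ such that $(x_n)$ dominates $(y_n)$ and at least one of the following three conditions holds. (i) For every scalar $\lambda$, the sequence $(y_n-\lambda x_n)$ has no converging subsequence. (ii) There exists a scalar $\lambda$ such that $(y_n-\lambda x_n)$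 converges, and there exists a bounded sequence $(z_n)$ in the linear span of $\{x_i\}_i$ such that $(w_n-\lambda z_n)$ has no converging subsequence, where each $w_n$ in the linear span of $\{y_i\}_i$ has the same distribution with respect to $(y_i)$ as $z_n$ has with respect to $(x_i)$; that is, $z_n=\sum_i a_{n,i}x_i$ and $w_n=\sum_i a_{n,i}y_i$ for the same finitely supported scalars $(a_{n,i})_i$. (iii) There exist scalars $\lambda_1\neq\lambda_2$ and strictly increasing sequences $(k^1_n)$, $(k^2_n)$ of natural numbers such that $(y_{k^i_n}-\lambda_i x_{k^i_n})_n$ converges for $i\in\{1,2\}$. -/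

import Mathlib

open Filter Topology

namespace InclusionCompact

section
variable (𝕜 : Type*) [RCLike 𝕜] {X : Type*} [NormedAddCommGroup X] [NormedSpace 𝕜 X]

/-- The closed linear span `[(x_n)]` of a sequence `(x_n)` in `X`. -/
abbrev closedSpan (x : ℕ → X) : Submodule 𝕜 X :=
  (Submodule.span 𝕜 (Set.range x)).topologicalClosure

/-- `(x_n)` is a basic sequence: it is a Schauder basis of its closed linear span. -/
def IsBasicSequence (x : ℕ → X) : Prop :=
  ∃ b : SchauderBasis 𝕜 (closedSpan 𝕜 x), ∀ n, (b.basis n : X) = x n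

/-- `(x_n)` dominates `(y_n)`: for some constant `C`,
`‖∑ a_i y_i‖ ≤ C ‖∑ a_i x_i‖` for all finitely supported scalar sequences `(a_i)`. -/
def Dominates (x y : ℕ → X) : Prop :=
  ∃ C : ℝ, ∀ a : ℕ →₀ 𝕜,
    ‖Finsupp.linearCombination 𝕜 y a‖ ≤ C * ‖Finsupp.linearCombination 𝕜 x a‖

/-- `w` has the same distribution with respect to `(y_i)` as `z` has with respect to `(x_i)`:
for one finitely supported `(a_i)`, `z = ∑ a_i x_i` and `w = ∑ a_i y_i`. -/
def SameDistribution (w : X) (y : ℕ → X) (z : X) (x : ℕ → X) : Prop :=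
  ∃ a : ℕ →₀ 𝕜, z = Finsupp.linearCombination 𝕜 x a ∧ w = Finsupp.linearCombination 𝕜 y a

/-- `T : Y → X` belongs to `𝕜 i_{Y → X} + K(Y, X)`: it is a compact perturbation of a scalar
multiple of the inclusion map of the subspace `Y` of `X`. -/
def IsMultipleOfInclusionPlusCompact {Y : Submodule 𝕜 X} (T : Y →L[𝕜] X) : Prop :=
  ∃ (c : 𝕜) (K : Y →L[𝕜] X), IsCompactOperator K ∧ T = c • Y.subtypeL + K

end

section
variable {X : Type*} [NormedAddCommGroup X]

/-- `(x_n)` is seminormalized: `0 < inf ‖x_n‖ ≤ sup ‖x_n‖ < ∞`. -/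
def IsSeminormalized (x : ℕ → X) : Prop :=
  ∃ m M : ℝ, 0 < m ∧ ∀ n, m ≤ ‖x n‖ ∧ ‖x n‖ ≤ M

/-- The sequence `(u_n)` converges in `X`. -/
def Converges (u : ℕ → X) : Prop :=
  ∃ l : X, Tendsto u atTop (𝓝 l)

/-- The sequence `(u_n)` has a converging subsequence. -/
def HasConvergingSubsequence (u : ℕ → X) : Prop :=
  ∃ k : ℕ → ℕ, StrictMono k ∧ Converges (fun n => u (k n))

end

end InclusionCompact

/-!
# Operators that are not compact perturbations of multiples of the inclusion

From sequences to an operator: by domination, `x_n ↦ y_n` extends to an operator `T` on the closed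
span of `(x_n)` (`exists_clm_of_dominates`). If `T = c i + K` with `K` compact, then
`(y_n - c x_n) = (K x_n)` has a converging subsequence. The sequence `(x_n)` itself has none
(`not_hasConvergingSubsequence_of_isBasicSequence`), so `c` is the only scalar for which
`(y_n - c x_n)` converges along a subsequence (`eq_of_converges_subseq`). Each of the three
conditions contradicts this or the compactness of `K`.

From an operator to sequences: all sequences used are block bases of the given basis, which are
basic sequences (`IsBlockBasis.isBasicSequence`), and `y_n = T x_n`. If the first condition fails
for the normalized basis, then `(T - c) x_{k_n}` converges for some scalar `c` and some subsequence.
The operator `T - c` is not compact. Subtracting the finite rank operator `(T - c) P_m` does not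
change how far the image of the unit ball is from being totally bounded, so there are bounded
vectors supported arbitrarily far out in the basis whose images stay at least a fixed distance from
any given finite set (`exists_block_image_far`). They yield a seminormalized block basis `(v_n)`
such that `((T - c) v_n)` is separated
(`exists_isBlockBasis_image_not_hasConvergingSubsequence`). If the first condition fails for
`(v_n)` too, then `(T - d) v_{l_n}` converges for some `d`, and `d ≠ c` by separation. Members of
the two subsequences with successive supports can be interleaved into one block basis
(`IsBlockBasis.exists_interleave`), which satisfies the third condition. The second condition is
not needed in this direction.
-/

namespace InclusionCompact

section

variable {𝕜 : Type*} [RCLike 𝕜] {X : Type*} [NormedAddCommGroup X] [NormedSpace 𝕜 X]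
variable {E : Type*} [NormedAddCommGroup E] [NormedSpace 𝕜 E]

/-! ### Closed spans and coordinates -/

theorem denseRange_linearCombination_closedSpan (x : ℕ → X) (x' : ℕ → closedSpan 𝕜 x)
    (hx' : ∀ n, (x' n : X) = x n) : DenseRange (Finsupp.linearCombination 𝕜 x') := by
  have hval : ∀ a : ℕ →₀ 𝕜, ((Finsupp.linearCombination 𝕜 x' a : closedSpan 𝕜 x) : X) =
      Finsupp.linearCombination 𝕜 x a := by
    intro a
    simp [Finsupp.linearCombination_apply, Finsupp.sum, hx']
  intro y
  rw [closure_subtype, ← Set.range_comp]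
  have hy : (y : X) ∈ closure (Submodule.span 𝕜 (Set.range x) : Set X) := by
    rw [← Submodule.topologicalClosure_coe]; exact y.2
  refine closure_mono ?_ hy
  intro z hz
  obtain ⟨a, rfl⟩ := Finsupp.mem_span_range_iff_exists_finsupp.1 hz
  exact ⟨a, (hval a).trans (Finsupp.linearCombination_apply 𝕜 a)⟩

theorem coord_basis_of_ne (b : SchauderBasis 𝕜 E) {i j : ℕ} (h : i ≠ j) :
    b.coord i (b j) = 0 := by
  simp [b.ortho, h]

theorem coord_basis_self (b : SchauderBasis 𝕜 E) (i : ℕ) : b.coord i (b i) = 1 := by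
  simp [b.ortho]

theorem basis_ne_zero (b : SchauderBasis 𝕜 E) (i : ℕ) : b i ≠ 0 := by
  intro h
  have := coord_basis_self b i
  simp [h] at this

theorem eq_zero_of_coord_eq_zero (b : SchauderBasis 𝕜 E) {v : E} (h : ∀ i, b.coord i v = 0) :
    v = 0 := by
  have := SchauderBasis.tendsto_proj b v
  simp only [SchauderBasis.proj_apply, h, zero_smul, Finset.sum_const_zero] at this
  exact (tendsto_nhds_unique this tendsto_const_nhds)

theorem proj_eq_self_of_coord_eq_zero (b : SchauderBasis 𝕜 E) {v : E} {N : ℕ}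
    (h : ∀ i, N ≤ i → b.coord i v = 0) : SchauderBasis.proj b N v = v := by
  refine tendsto_nhds_unique ?_ (SchauderBasis.tendsto_proj b v)
  refine tendsto_const_nhds.congr' ?_
  filter_upwards [eventually_ge_atTop N] with M hM
  simp only [SchauderBasis.proj_apply]
  refine Finset.sum_subset (Finset.range_subset_range.2 hM) fun i _ hi => ?_
  rw [h i (by simpa using hi), zero_smul]

theorem proj_eq_zero_of_coord_eq_zero (b : SchauderBasis 𝕜 E) {v : E} {N : ℕ}
    (h : ∀ i, i < N → b.coord i v = 0) : SchauderBasis.proj b N v = 0 := by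
  simp only [SchauderBasis.proj_apply]
  refine Finset.sum_eq_zero fun i hi => ?_
  rw [h i (by simpa using hi), zero_smul]

theorem coord_proj (b : SchauderBasis 𝕜 E) (i n : ℕ) (v : E) :
    b.coord i (SchauderBasis.proj b n v) = if i < n then b.coord i v else 0 := by
  simp [SchauderBasis.proj_apply, b.ortho, Pi.single_apply]

/-! ### Block bases -/

/-- `(v_j)` is a block basis of `b` along the cut points `(n_j)`: each `v_j` is nonzero and its
coordinates vanish outside `[n_j, n_{j+1})`. The blocks need not start at `0`. -/
def IsBlockBasis (b : SchauderBasis 𝕜 E) (n : ℕ → ℕ) (v : ℕ → E) : Prop :=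
  StrictMono n ∧ ∀ j, v j ≠ 0 ∧ ∀ i, b.coord i (v j) ≠ 0 → n j ≤ i ∧ i < n (j + 1)

theorem IsBlockBasis.proj_apply {b : SchauderBasis 𝕜 E} {n : ℕ → ℕ} {v : ℕ → E}
    (h : IsBlockBasis b n v) (j k : ℕ) :
    SchauderBasis.proj b (n k) (v j) = if j < k then v j else 0 := by
  split_ifs with hjk
  · refine proj_eq_self_of_coord_eq_zero b fun i hi => ?_
    by_contra hne
    have h1 := ((h.2 j).2 i hne).2
    have h2 := h.1.monotone (Nat.succ_le_of_lt hjk)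
    simp only [Nat.succ_eq_add_one] at h2
    omega
  · refine proj_eq_zero_of_coord_eq_zero b fun i hi => ?_
    by_contra hne
    have h1 := ((h.2 j).2 i hne).1
    have h2 := h.1.monotone (not_lt.1 hjk)
    omega

/-- A block basis is a basic sequence: the `j`-th coordinate functional of its closed span is a
multiple of one original coordinate functional `i_j` with `b.coord i_j (v j) ≠ 0`, and the partial
sums of the expansion are the original partial sums along the cut points. -/
theorem IsBlockBasis.isBasicSequence {Y : Submodule 𝕜 X} (hY : IsClosed (Y : Set X))
    {b : SchauderBasis 𝕜 Y} {n : ℕ → ℕ} {v : ℕ → Y} (h : IsBlockBasis b n v) :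
    IsBasicSequence 𝕜 (fun j => (v j : X)) := by
  have hle : closedSpan 𝕜 (fun j => (v j : X)) ≤ Y := by
    refine Submodule.topologicalClosure_minimal _ (Submodule.span_le.2 ?_) hY
    rintro _ ⟨j, rfl⟩
    exact (v j).2
  set W := closedSpan 𝕜 (fun j => (v j : X)) with hW
  have hmem : ∀ j, (v j : X) ∈ W := fun j =>
    Submodule.le_topologicalClosure _ (Submodule.subset_span ⟨j, rfl⟩)
  let J : W →L[𝕜] Y := W.subtypeL.codRestrict Y fun w => hle w.2
  let e : ℕ → W := fun j => ⟨v j, hmem j⟩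
  have hJe : ∀ j, J (e j) = v j := fun j => Subtype.ext rfl
  have hidx : ∀ j, ∃ i, b.coord i (v j) ≠ 0 := fun j => by
    by_contra! hc
    exact (h.2 j).1 (eq_zero_of_coord_eq_zero b hc)
  choose i hi using hidx
  let φ : ℕ → StrongDual 𝕜 W := fun j =>
    (b.coord (i j) (v j))⁻¹ • (b.coord (i j)).comp J
  have hφ : ∀ j k, φ j (e k) = if j = k then 1 else 0 := by
    intro j k
    simp only [φ, smul_apply, ContinuousLinearMap.comp_apply, hJe, smul_eq_mul]
    rcases eq_or_ne j k with rfl | hjk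
    · rw [if_pos rfl, inv_mul_cancel₀ (hi j)]
    · rw [if_neg hjk]
      have : b.coord (i j) (v k) = 0 := by
        by_contra hne
        have h1 := (h.2 k).2 _ hne
        have h2 := (h.2 j).2 _ (hi j)
        rcases lt_or_gt_of_ne hjk with hlt | hlt
        · have := h.1.monotone (Nat.succ_le_of_lt hlt)
          simp only [Nat.succ_eq_add_one] at this
          omega
        · have := h.1.monotone (Nat.succ_le_of_lt hlt)
          simp only [Nat.succ_eq_add_one] at this
          omega
      rw [this, mul_zero]
  have hdense : DenseRange (Finsupp.linearCombination 𝕜 e) :=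
    denseRange_linearCombination_closedSpan _ e fun _ => rfl
  -- Both sides are continuous and linear in `w` and agree on the blocks.
  have hsum : ∀ k, ∀ w : W, J (∑ j ∈ Finset.range k, φ j w • e j) =
      SchauderBasis.proj b (n k) (J w) := by
    intro k w
    refine hdense.induction_on (p := fun w => J (∑ j ∈ Finset.range k, φ j w • e j) =
      SchauderBasis.proj b (n k) (J w)) w (isClosed_eq (by fun_prop) (by fun_prop)) ?_
    intro a
    induction a using Finsupp.induction_linear with
    | zero => simp
    | add f g hf hg => simp only [map_add, add_smul, Finset.sum_add_distrib, hf, hg]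
    | single l c =>
      have hc : ∀ j, φ j (c • e l) • e j = if j = l then c • e l else 0 := by
        intro j
        rw [map_smul, hφ]
        split_ifs with hjl
        · simp [hjl]
        · simp
      simp only [Finsupp.linearCombination_single, hc, Finset.sum_ite_eq', Finset.mem_range]
      rw [map_smul, map_smul, hJe, h.proj_apply]
      split_ifs
      · rw [map_smul, hJe]
      · simp
  refine ⟨⟨e, φ, fun _ _ => (hφ _ _).trans (by simp [Pi.single_apply]), fun w => ?_⟩, fun _ => rfl⟩
  rw [HasSum, SummationFilter.conditional_filter_eq_map_range, tendsto_map'_iff]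
  have hlim := (SchauderBasis.tendsto_proj b (J w)).comp h.1.tendsto_atTop
  rw [tendsto_subtype_rng] at hlim ⊢
  refine hlim.congr fun k => ?_
  simp only [Function.comp]
  rw [← hsum k w]
  rfl

theorem IsBlockBasis.exists_interleave {b : SchauderBasis 𝕜 E} {n n' : ℕ → ℕ} {v w : ℕ → E}
    (hv : IsBlockBasis b n v) (hw : IsBlockBasis b n' w) {k l : ℕ → ℕ} (hk : StrictMono k)
    (hl : StrictMono l) :
    ∃ (c : ℕ → ℕ) (u : ℕ → E) (p q : ℕ → ℕ), IsBlockBasis b c u ∧ StrictMono p ∧ StrictMono q ∧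
      (∀ j, u (2 * j) = v (k (p j))) ∧ ∀ j, u (2 * j + 1) = w (l (q j)) := by
  -- A pair `(p, q)` stands for the block `v (k p)` followed by the block `w (l q)`.
  obtain ⟨f, hf, hsep⟩ := exists_seq_of_forall_finset_exists
    (P := fun a : ℕ × ℕ => n (k a.1 + 1) ≤ n' (l a.2))
    (r := fun a a' => a.1 < a'.1 ∧ a.2 < a'.2 ∧ n' (l a.2 + 1) ≤ n (k a'.1)) (by
      intro s _
      set p := ∑ a ∈ s, (a.1 + 1 + n' (l a.2 + 1)) with hp
      set q := ∑ a ∈ s, (a.2 + 1) + n (k p + 1) with hq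
      have hpn : p ≤ n (k p) := (hk.le_apply).trans hv.1.le_apply
      have hqn : q ≤ n' (l q) := (hl.le_apply).trans hw.1.le_apply
      refine ⟨(p, q), by dsimp only; omega, fun a ha => ?_⟩
      have h1 : a.1 + 1 + n' (l a.2 + 1) ≤ p :=
        Finset.single_le_sum (f := fun a : ℕ × ℕ => a.1 + 1 + n' (l a.2 + 1))
          (fun _ _ => Nat.zero_le _) ha
      have h2 : a.2 + 1 ≤ ∑ a ∈ s, (a.2 + 1) :=
        Finset.single_le_sum (f := fun a : ℕ × ℕ => a.2 + 1) (fun _ _ => Nat.zero_le _) ha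
      dsimp only
      omega)
  let c : ℕ → ℕ := fun j => if j % 2 = 0 then n (k (f (j / 2)).1) else n' (l (f (j / 2)).2)
  let u : ℕ → E := fun j => if j % 2 = 0 then v (k (f (j / 2)).1) else w (l (f (j / 2)).2)
  have hodd : ∀ j, (2 * j + 1) / 2 = j := fun j => by omega
  have hodd' : ∀ j, (2 * j + 1) % 2 ≠ 0 := fun j => by omega
  have hc0 : ∀ j, c (2 * j) = n (k (f j).1) := fun j => by simp [c]
  have hc1 : ∀ j, c (2 * j + 1) = n' (l (f j).2) := fun j => by simp [c, hodd]
  have hu0 : ∀ j, u (2 * j) = v (k (f j).1) := fun j => by simp [u]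
  have hu1 : ∀ j, u (2 * j + 1) = w (l (f j).2) := fun j => by simp [u, hodd]
  have hstep0 : ∀ j, n (k (f j).1 + 1) ≤ c (2 * j + 1) := fun j => (hf j).trans_eq (hc1 j).symm
  have hstep1 : ∀ j, n' (l (f j).2 + 1) ≤ c (2 * j + 1 + 1) := fun j => by
    rw [show 2 * j + 1 + 1 = 2 * (j + 1) by ring, hc0]
    exact (hsep j _ (Nat.lt_succ_self j)).2.2
  refine ⟨c, u, fun j => (f j).1, fun j => (f j).2, ⟨strictMono_nat_of_lt_succ fun i => ?_,
    fun i => ?_⟩, strictMono_nat_of_lt_succ fun j => (hsep j _ (Nat.lt_succ_self j)).1,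
    strictMono_nat_of_lt_succ fun j => (hsep j _ (Nat.lt_succ_self j)).2.1, hu0, hu1⟩
  · obtain ⟨j, rfl | rfl⟩ := Nat.even_or_odd' i
    · rw [hc0]
      exact (hv.1 (Nat.lt_succ_self _)).trans_le (hstep0 j)
    · rw [hc1]
      exact (hw.1 (Nat.lt_succ_self _)).trans_le (hstep1 j)
  · obtain ⟨j, rfl | rfl⟩ := Nat.even_or_odd' i
    · rw [hu0, hc0]
      refine ⟨(hv.2 _).1, fun i hi => ?_⟩
      have := (hv.2 _).2 i hi
      exact ⟨this.1, this.2.trans_le (hstep0 j)⟩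
    · rw [hu1, hc1]
      refine ⟨(hw.2 _).1, fun i hi => ?_⟩
      have := (hw.2 _).2 i hi
      exact ⟨this.1, this.2.trans_le (hstep1 j)⟩

theorem exists_isBlockBasis_norm_eq_one (b : SchauderBasis 𝕜 E) :
    ∃ v : ℕ → E, IsBlockBasis b id v ∧ ∀ j, ‖v j‖ = 1 := by
  have hnorm : ∀ j, ‖((‖b j‖⁻¹ : ℝ) : 𝕜) • b j‖ = 1 := fun j => by
    rw [norm_smul, RCLike.norm_ofReal, abs_inv, abs_norm,
      inv_mul_cancel₀ (norm_ne_zero_iff.2 (basis_ne_zero b j))]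
  refine ⟨fun j => ((‖b j‖⁻¹ : ℝ) : 𝕜) • b j, ⟨strictMono_id, fun j => ⟨?_, fun i hi => ?_⟩⟩, hnorm⟩
  · intro h0
    have := hnorm j
    dsimp only at h0
    rw [h0, norm_zero] at this
    exact zero_ne_one this
  · by_cases hij : i = j
    · subst hij; simp
    · rw [map_smul, coord_basis_of_ne b hij, smul_zero] at hi
      exact absurd rfl hi

/-! ### Domination and operators -/

theorem dominates_of_clm {Y : Submodule 𝕜 X} (T : Y →L[𝕜] X) (v : ℕ → Y) :
    Dominates 𝕜 (fun j => (v j : X)) (fun j => T (v j)) := by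
  refine ⟨‖T‖, fun a => ?_⟩
  have h1 : Finsupp.linearCombination 𝕜 (fun j => T (v j)) a =
      T (Finsupp.linearCombination 𝕜 v a) := by
    simp [Finsupp.linearCombination_apply, Finsupp.sum, map_sum]
  have h2 : Finsupp.linearCombination 𝕜 (fun j => (v j : X)) a =
      ((Finsupp.linearCombination 𝕜 v a : Y) : X) := by
    simp [Finsupp.linearCombination_apply, Finsupp.sum]
  rw [h1, h2]
  exact T.le_opNorm _

theorem exists_clm_of_dominates [CompleteSpace X] {x y : ℕ → X} (h : Dominates 𝕜 x y) :
    ∃ T : closedSpan 𝕜 x →L[𝕜] X, ∀ (a : ℕ →₀ 𝕜)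
      (ha : Finsupp.linearCombination 𝕜 x a ∈ closedSpan 𝕜 x),
      T ⟨_, ha⟩ = Finsupp.linearCombination 𝕜 y a := by
  let e : ℕ → closedSpan 𝕜 x := fun n =>
    ⟨x n, Submodule.le_topologicalClosure _ (Submodule.subset_span ⟨n, rfl⟩)⟩
  have hval : ∀ a : ℕ →₀ 𝕜, ((Finsupp.linearCombination 𝕜 e a : closedSpan 𝕜 x) : X) =
      Finsupp.linearCombination 𝕜 x a := by
    intro a
    simp [Finsupp.linearCombination_apply, Finsupp.sum, e]
  obtain ⟨C, hC⟩ := h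
  refine ⟨(Finsupp.linearCombination 𝕜 y).extendOfNorm (Finsupp.linearCombination 𝕜 e),
    fun a ha => ?_⟩
  rw [← LinearMap.extendOfNorm_eq (denseRange_linearCombination_closedSpan x e fun _ => rfl)
    (f := Finsupp.linearCombination 𝕜 y) ⟨C, fun a => ?_⟩ a]
  · congr 1
    exact Subtype.ext (hval a).symm
  · rw [Submodule.coe_norm, hval]
    exact hC a

/-! ### Block bases detecting noncompactness -/

theorem isCompactOperator_comp_proj (b : SchauderBasis 𝕜 E) (S : E →L[𝕜] X) (m : ℕ) :
    IsCompactOperator (S ∘ SchauderBasis.proj b m) := by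
  induction m with
  | zero =>
    rw [SchauderBasis.proj_zero, show S ∘ (0 : E →L[𝕜] E) = 0 from funext fun _ => map_zero S]
    exact isCompactOperator_zero
  | succ m ih =>
    have h1 : IsCompactOperator
        ((fun c : 𝕜 => c • S (b m)) ∘ b.coord m) := by
      refine IsCompactOperator.comp_clm ?_ (b.coord m)
      refine ⟨(fun c : 𝕜 => c • S (b m)) '' Metric.closedBall 0 1,
        (isCompact_closedBall _ _).image (by fun_prop), ?_⟩
      exact mem_of_superset (Metric.closedBall_mem_nhds 0 one_pos) (Set.subset_preimage_image _ _)
    have h2 : S ∘ SchauderBasis.proj b (m + 1) =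
        S ∘ SchauderBasis.proj b m + (fun c : 𝕜 => c • S (b m)) ∘ b.coord m := by
      funext w
      simp [SchauderBasis.proj_apply, Finset.sum_range_succ]
    rw [h2]
    exact ih.add h1

/-- Noncompactness of `S` is visible on finitely supported vectors arbitrarily far out in the
basis, with a separation `δ` that does not depend on how far: removing the first `m` coordinates
changes `S` by a finite rank operator. -/
theorem exists_block_image_far [CompleteSpace X] [CompleteSpace E] (b : SchauderBasis 𝕜 E)
    (S : E →L[𝕜] X) (hS : ¬ IsCompactOperator S) :
    ∃ C δ : ℝ, 0 < δ ∧ ∀ (m : ℕ) (F : Finset X), ∃ (v : E) (N : ℕ),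
      (∀ i, b.coord i v ≠ 0 → m ≤ i ∧ i < N) ∧ ‖v‖ ≤ C ∧ ∀ f ∈ F, δ < ‖S v - f‖ := by
  have hnot : ¬ TotallyBounded (S '' Metric.closedBall 0 1) := fun ht =>
    hS ((isCompactOperator_iff_isCompact_closure_image_closedBall (S : E →ₗ[𝕜] X) one_pos).2
      (ht.closure.isCompact_of_isClosed isClosed_closure))
  rw [Metric.totallyBounded_iff] at hnot
  push Not at hnot
  obtain ⟨ε, hε, hcov⟩ := hnot
  obtain ⟨C, hC⟩ := SchauderBasis.exists_norm_proj_le b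
  refine ⟨C + C, ε / 4, by positivity, fun m F => ?_⟩
  have hfin : TotallyBounded ((S ∘ SchauderBasis.proj b m) '' Metric.closedBall 0 1) := by
    have := IsCompactOperator.isCompact_closure_image_closedBall
      (f := ((S.comp (SchauderBasis.proj b m) : E →L[𝕜] X) : E →ₗ[𝕜] X))
      (isCompactOperator_comp_proj b S m) 1
    exact this.totallyBounded.subset subset_closure
  obtain ⟨G, hG, hGcov⟩ := Metric.totallyBounded_iff.1 hfin (ε / 2) (by positivity)
  -- A vector of the unit ball whose image under `S ∘ (1 - P_m)` stays away from `F`.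
  obtain ⟨z, hz, hzF⟩ : ∃ z ∈ Metric.closedBall (0 : E) 1,
      ∀ f ∈ F, ε / 4 < ‖S (z - SchauderBasis.proj b m z) - f‖ := by
    by_contra! hcon
    refine hcov (Set.image2 (· + ·) (F : Set X) G) (F.finite_toSet.image2 _ hG) ?_
    rintro _ ⟨z, hz, rfl⟩
    obtain ⟨f, hf, hfz⟩ := hcon z hz
    obtain ⟨g, hg, hgz⟩ := Set.mem_iUnion₂.1 (hGcov ⟨z, hz, rfl⟩)
    refine Set.mem_iUnion₂.2 ⟨f + g, ⟨f, hf, g, hg, rfl⟩, ?_⟩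
    rw [Metric.mem_ball, dist_eq_norm] at hgz ⊢
    have : S z - (f + g) = (S (z - SchauderBasis.proj b m z) - f) +
        ((S ∘ SchauderBasis.proj b m) z - g) := by
      simp only [map_sub, Function.comp]; abel
    rw [this]
    refine (norm_add_le _ _).trans_lt ?_
    linarith
  have hlim : Tendsto (fun N => S (SchauderBasis.proj b N z - SchauderBasis.proj b m z)) atTop
      (𝓝 (S (z - SchauderBasis.proj b m z))) :=
    (S.continuous.tendsto _).comp ((SchauderBasis.tendsto_proj b z).sub_const _)
  have hev : ∀ᶠ N in atTop, ∀ f ∈ F,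
      ε / 4 < ‖S (SchauderBasis.proj b N z - SchauderBasis.proj b m z) - f‖ := by
    rw [Filter.eventually_all_finset]
    intro f hf
    exact (hlim.sub_const f).norm.eventually_const_lt (hzF f hf)
  obtain ⟨N, hN, hmN⟩ := (hev.and (eventually_ge_atTop m)).exists
  refine ⟨_, N, fun i hi => ?_, ?_, hN⟩
  · rw [map_sub, coord_proj, coord_proj] at hi
    split_ifs at hi <;> first | omega | simp at hi
  · have hbd : ∀ k, ‖SchauderBasis.proj b k z‖ ≤ C := fun k =>
      ((SchauderBasis.proj b k).le_opNorm_of_le (by simpa using hz)).trans (by simpa using hC k)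
    exact (norm_sub_le _ _).trans (add_le_add (hbd N) (hbd m))

theorem not_hasConvergingSubsequence_of_separated {u : ℕ → X} {δ : ℝ} (hδ : 0 < δ)
    (h : ∀ i j, i < j → δ < ‖u j - u i‖) : ¬ HasConvergingSubsequence u := by
  rintro ⟨k, hk, l, hl⟩
  obtain ⟨N, hN⟩ := Metric.cauchySeq_iff'.1 hl.cauchySeq δ hδ
  have h1 := hN (N + 1) (Nat.le_succ N)
  rw [dist_eq_norm] at h1
  exact lt_asymm h1 (h _ _ (hk (Nat.lt_succ_self N)))

theorem exists_isBlockBasis_image_not_hasConvergingSubsequence [CompleteSpace X] [CompleteSpace E]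
    (b : SchauderBasis 𝕜 E) (S : E →L[𝕜] X) (hS : ¬ IsCompactOperator S) :
    ∃ (n : ℕ → ℕ) (v : ℕ → E), IsBlockBasis b n v ∧ IsSeminormalized v ∧
      ¬ HasConvergingSubsequence (fun j => S (v j)) := by
  classical
  obtain ⟨C, δ, hδ, hfar⟩ := exists_block_image_far b S hS
  -- A triple `(v, m, N)` stands for a vector `v` supported in `[m, N)`.
  obtain ⟨f, hf, hsep⟩ := exists_seq_of_forall_finset_exists
    (P := fun a : E × ℕ × ℕ => (∀ i, b.coord i a.1 ≠ 0 → a.2.1 ≤ i ∧ i < a.2.2) ∧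
      ‖a.1‖ ≤ C ∧ δ < ‖S a.1‖)
    (r := fun a a' => a.2.1 < a'.2.1 ∧ a.2.2 ≤ a'.2.1 ∧ δ < ‖S a'.1 - S a.1‖) (by
      intro s _
      set m := ∑ a ∈ s, (a.2.1 + 1 + a.2.2) with hm
      obtain ⟨v, N, hv, hvC, hvF⟩ := hfar m (insert 0 (s.image fun a => S a.1))
      refine ⟨(v, m, N), ⟨hv, hvC, by simpa using hvF 0 (by simp)⟩, fun a ha => ?_⟩
      have hle : a.2.1 + 1 + a.2.2 ≤ m :=
        Finset.single_le_sum (f := fun a : E × ℕ × ℕ => a.2.1 + 1 + a.2.2)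
          (fun _ _ => Nat.zero_le _) ha
      exact ⟨by dsimp only; omega, by dsimp only; omega,
        hvF _ (Finset.mem_insert_of_mem (Finset.mem_image_of_mem _ ha))⟩)
  have hlow : ∀ j, δ / (‖S‖ + 1) ≤ ‖(f j).1‖ := fun j => by
    rw [div_le_iff₀ (by positivity)]
    have h1 := S.le_opNorm (f j).1
    have h2 := (hf j).2.2
    nlinarith [norm_nonneg (f j).1]
  have hpos : 0 < δ / (‖S‖ + 1) := by positivity
  refine ⟨fun j => (f j).2.1, fun j => (f j).1,
    ⟨strictMono_nat_of_lt_succ fun j => (hsep j _ (Nat.lt_succ_self j)).1, fun j => ⟨?_, ?_⟩⟩,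
    ⟨_, C, hpos, fun j => ⟨hlow j, (hf j).2.1⟩⟩,
    not_hasConvergingSubsequence_of_separated hδ fun i j hij => (hsep i j hij).2.2⟩
  · exact norm_pos_iff.1 (hpos.trans_le (hlow j))
  · intro i hi
    exact ⟨((hf j).1 i hi).1, ((hf j).1 i hi).2.trans_le (hsep j _ (Nat.lt_succ_self j)).2.1⟩

/-! ### Seminormalized basic sequences and compact operators -/

/-- All coordinates of a limit of a subsequence of a basic sequence vanish, so the limit is `0`. -/
theorem not_hasConvergingSubsequence_of_isBasicSequence {x : ℕ → X} (hx : IsBasicSequence 𝕜 x)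
    (hsn : IsSeminormalized x) : ¬ HasConvergingSubsequence x := by
  rintro ⟨k, hk, l, hl⟩
  obtain ⟨b, hb⟩ := hx
  obtain ⟨m, M, hm, hmM⟩ := hsn
  have hlY : l ∈ closedSpan 𝕜 x := by
    refine (Submodule.isClosed_topologicalClosure _).mem_of_tendsto hl (.of_forall fun n => ?_)
    exact Submodule.le_topologicalClosure _ (Submodule.subset_span ⟨_, rfl⟩)
  have hlim : Tendsto (fun n => b (k n)) atTop (𝓝 (⟨l, hlY⟩ : closedSpan 𝕜 x)) := by
    rw [tendsto_subtype_rng]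
    simpa only [hb] using hl
  have hl0 : (⟨l, hlY⟩ : closedSpan 𝕜 x) = 0 := by
    refine eq_zero_of_coord_eq_zero b fun i => ?_
    refine tendsto_nhds_unique (((b.coord i).continuous.tendsto _).comp hlim) ?_
    refine tendsto_const_nhds.congr' ?_
    filter_upwards [eventually_gt_atTop i] with n hn
    exact (coord_basis_of_ne b (hn.trans_le hk.le_apply).ne).symm
  have hl0' : l = 0 := congrArg Subtype.val hl0
  have := ge_of_tendsto hl.norm (.of_forall fun n => (hmM (k n)).1)
  rw [hl0', norm_zero] at this
  exact hm.not_ge this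

theorem hasConvergingSubsequence_of_isCompactOperator {K : E →L[𝕜] X} (hK : IsCompactOperator K)
    {u : ℕ → E} (hu : Bornology.IsBounded (Set.range u)) :
    HasConvergingSubsequence (fun n => K (u n)) := by
  have hc := IsCompactOperator.isCompact_closure_image_of_bounded (f := (K : E →ₗ[𝕜] X)) hK hu
  obtain ⟨l, _, k, hk, hl⟩ := hc.tendsto_subseq (x := fun n => K (u n))
    fun n => subset_closure ⟨_, ⟨n, rfl⟩, rfl⟩
  exact ⟨k, hk, l, hl⟩

/-- If every subsequence of `(y_n - c x_n)` has a converging subsequence, as it does when a compact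
perturbation of `c` times the inclusion maps `x_n` to `y_n`, then `c` is the only scalar `d` for
which `(y_n - d x_n)` converges along a subsequence. -/
theorem eq_of_converges_subseq {x y : ℕ → X} (hx : IsBasicSequence 𝕜 x) (hsn : IsSeminormalized x)
    {c d : 𝕜} (hK : ∀ k : ℕ → ℕ, HasConvergingSubsequence fun n => y (k n) - c • x (k n))
    {k : ℕ → ℕ} (hk : StrictMono k) (h : Converges fun n => y (k n) - d • x (k n)) : d = c := by
  by_contra hne
  obtain ⟨j, hj, l, hl⟩ := hK k
  obtain ⟨l', hl'⟩ := h
  refine not_hasConvergingSubsequence_of_isBasicSequence hx hsn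
    ⟨k ∘ j, hk.comp hj, (d - c)⁻¹ • (l - l'), ?_⟩
  refine ((hl.sub (hl'.comp hj.tendsto_atTop)).const_smul (d - c)⁻¹).congr fun n => ?_
  rw [inv_smul_eq_iff₀ (sub_ne_zero.2 hne), sub_smul]
  simp only [Function.comp]
  abel

/-! ### Sequences from an operator -/

/-- For a seminormalized block basis `v` and `y = T v`, either the first condition holds or, for
some scalar `c`, `T - c` sends a subsequence of `v` to a convergent sequence. When this second
alternative holds for the normalized basis, with scalar `c`, the noncompact operator `T - c` has a
block basis of its own on which it can only hold with a scalar other than `c`; interleaving the two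
subsequences then gives the third condition. -/
theorem exists_sequences_of_not_isMultipleOfInclusionPlusCompact [CompleteSpace X]
    {Y : Submodule 𝕜 X} (hY : IsClosed (Y : Set X)) (b : SchauderBasis 𝕜 Y) (T : Y →L[𝕜] X)
    (hT : ¬ IsMultipleOfInclusionPlusCompact 𝕜 T) :
    ∃ x y : ℕ → X, IsBasicSequence 𝕜 x ∧ IsSeminormalized x ∧ Dominates 𝕜 x y ∧
      ((∀ c : 𝕜, ¬ HasConvergingSubsequence (fun n => y n - c • x n)) ∨
       (∃ c₁ c₂ : 𝕜, c₁ ≠ c₂ ∧ ∃ k₁ k₂ : ℕ → ℕ, StrictMono k₁ ∧ StrictMono k₂ ∧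
          Converges (fun n => y (k₁ n) - c₁ • x (k₁ n)) ∧
          Converges (fun n => y (k₂ n) - c₂ • x (k₂ n)))) := by
  have : CompleteSpace Y := hY.completeSpace_coe
  obtain ⟨v, hv, hv1⟩ := exists_isBlockBasis_norm_eq_one b
  have hvsn : IsSeminormalized (fun j => (v j : X)) :=
    ⟨1, 1, one_pos, fun j => ⟨(hv1 j).ge, (hv1 j).le⟩⟩
  by_cases hi : ∀ c : 𝕜, ¬ HasConvergingSubsequence (fun n => T (v n) - c • (v n : X))
  · exact ⟨_, _, hv.isBasicSequence hY, hvsn, dominates_of_clm T v, Or.inl hi⟩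
  push Not at hi
  obtain ⟨c, k, hk, lv, hlv⟩ := hi
  have hS : ¬ IsCompactOperator (T - c • Y.subtypeL : Y →L[𝕜] X) := fun hS =>
    hT ⟨c, _, hS, (add_sub_cancel _ _).symm⟩
  obtain ⟨n', w, hw, hwsn, hwS⟩ :=
    exists_isBlockBasis_image_not_hasConvergingSubsequence b _ hS
  by_cases hi' : ∀ d : 𝕜, ¬ HasConvergingSubsequence (fun n => T (w n) - d • (w n : X))
  · exact ⟨_, _, hw.isBasicSequence hY, hwsn, dominates_of_clm T w, Or.inl hi'⟩
  push Not at hi'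
  obtain ⟨d, l, hl, lw, hlw⟩ := hi'
  have hcd : c ≠ d := by
    rintro rfl
    exact hwS ⟨l, hl, lw, hlw⟩
  obtain ⟨n, u, p, q, hu, hp, hq, hu0, hu1⟩ := hv.exists_interleave hw hk hl
  have husn : IsSeminormalized (fun j => (u j : X)) := by
    obtain ⟨m, M, hm, hmM⟩ := hwsn
    refine ⟨min 1 m, max 1 M, lt_min one_pos hm, fun i => ?_⟩
    obtain ⟨j, rfl | rfl⟩ := Nat.even_or_odd' i
    · simp only [hu0]
      exact ⟨(min_le_left _ _).trans (hv1 _).ge, (hv1 _).le.trans (le_max_left _ _)⟩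
    · simp only [hu1]
      exact ⟨(min_le_right _ _).trans (hmM _).1, (hmM _).2.trans (le_max_right _ _)⟩
  refine ⟨_, _, hu.isBasicSequence hY, husn, dominates_of_clm T u, Or.inr ⟨c, d, hcd,
    fun j => 2 * j, fun j => 2 * j + 1, fun i j h => by dsimp only; omega,
    fun i j h => by dsimp only; omega, ⟨lv, ?_⟩, ⟨lw, ?_⟩⟩⟩
  · simp only [hu0]
    exact hlv.comp hp.tendsto_atTop
  · simp only [hu1]
    exact hlw.comp hq.tendsto_atTop

end

end InclusionCompact

theorem proposition1p3 {𝕜 : Type*} [RCLike 𝕜] {X : Type*} [NormedAddCommGroup X]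
    [NormedSpace 𝕜 X] [CompleteSpace X] :
    (∃ x : ℕ → X, InclusionCompact.IsBasicSequence 𝕜 x ∧
      ∃ T : InclusionCompact.closedSpan 𝕜 x →L[𝕜] X,
        ¬ InclusionCompact.IsMultipleOfInclusionPlusCompact 𝕜 T) ↔
    (∃ x y : ℕ → X, InclusionCompact.IsBasicSequence 𝕜 x ∧
      InclusionCompact.IsSeminormalized x ∧
      InclusionCompact.Dominates 𝕜 x y ∧
      ((∀ c : 𝕜, ¬ InclusionCompact.HasConvergingSubsequence (fun n => y n - c • x n)) ∨
       (∃ c : 𝕜, InclusionCompact.Converges (fun n => y n - c • x n) ∧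
          ∃ z w : ℕ → X,
            (∀ n, z n ∈ Submodule.span 𝕜 (Set.range x)) ∧
            Bornology.IsBounded (Set.range z) ∧
            (∀ n, w n ∈ Submodule.span 𝕜 (Set.range y)) ∧
            (∀ n, InclusionCompact.SameDistribution 𝕜 (w n) y (z n) x) ∧
            ¬ InclusionCompact.HasConvergingSubsequence (fun n => w n - c • z n)) ∨
       (∃ c₁ c₂ : 𝕜, c₁ ≠ c₂ ∧ ∃ k₁ k₂ : ℕ → ℕ, StrictMono k₁ ∧ StrictMono k₂ ∧
          InclusionCompact.Converges (fun n => y (k₁ n) - c₁ • x (k₁ n)) ∧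
          InclusionCompact.Converges (fun n => y (k₂ n) - c₂ • x (k₂ n))))) := by
  open InclusionCompact in
  constructor
  · rintro ⟨x, ⟨b, -⟩, T, hT⟩
    obtain ⟨x', y', hx', hsn, hdom, h⟩ :=
      exists_sequences_of_not_isMultipleOfInclusionPlusCompact
        (Submodule.isClosed_topologicalClosure _) b T hT
    exact ⟨x', y', hx', hsn, hdom, h.imp_right Or.inr⟩
  · rintro ⟨x, y, hx, hsn, hdom, h⟩
    obtain ⟨T, hTlc⟩ := exists_clm_of_dominates hdom
    refine ⟨x, hx, T, ?_⟩
    rintro ⟨c, K, hK, hTK⟩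
    -- `K` acts on finite combinations of `x` as `T - c` does.
    have hKlc : ∀ (a : ℕ →₀ 𝕜) (ha : Finsupp.linearCombination 𝕜 x a ∈ closedSpan 𝕜 x),
        K ⟨_, ha⟩ = Finsupp.linearCombination 𝕜 y a - c • Finsupp.linearCombination 𝕜 x a := by
      intro a ha
      rw [← hTlc a ha, hTK]
      simp
    have hspan : ∀ z ∈ Submodule.span 𝕜 (Set.range x), z ∈ closedSpan 𝕜 x :=
      fun z hz => Submodule.le_topologicalClosure _ hz
    have hKsub : ∀ z w : ℕ → X, (∀ n, z n ∈ Submodule.span 𝕜 (Set.range x)) →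
        Bornology.IsBounded (Set.range z) → (∀ n, SameDistribution 𝕜 (w n) y (z n) x) →
        HasConvergingSubsequence fun n => w n - c • z n := by
      intro z w hz hbdd hsame
      have hbdd' : Bornology.IsBounded
          (Set.range fun n => (⟨z n, hspan _ (hz n)⟩ : closedSpan 𝕜 x)) := by
        obtain ⟨M, hM⟩ := isBounded_iff_forall_norm_le.1 hbdd
        refine isBounded_iff_forall_norm_le.2 ⟨M, ?_⟩
        rintro _ ⟨n, rfl⟩
        exact hM _ ⟨n, rfl⟩
      have hw : ∀ n, w n - c • z n = K ⟨z n, hspan _ (hz n)⟩ := by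
        intro n
        obtain ⟨a, ha, ha'⟩ := hsame n
        simp only [ha, ha', hKlc]
      simp only [hw]
      exact hasConvergingSubsequence_of_isCompactOperator hK hbdd'
    have hxsub : ∀ k : ℕ → ℕ, HasConvergingSubsequence fun n => y (k n) - c • x (k n) := by
      intro k
      obtain ⟨m, M, hm, hmM⟩ := id hsn
      refine hKsub (fun n => x (k n)) (fun n => y (k n))
        (fun n => Submodule.subset_span ⟨_, rfl⟩) (isBounded_iff_forall_norm_le.2 ⟨M, ?_⟩)
        fun n => ⟨Finsupp.single (k n) 1, by simp, by simp⟩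
      rintro _ ⟨n, rfl⟩
      exact (hmM _).2
    obtain hi | ⟨d, hconv, z, w, hz, hbdd, -, hsame, hno⟩ |
      ⟨c₁, c₂, hne, k₁, k₂, hk₁, hk₂, h₁, h₂⟩ := h
    · exact hi c (hxsub id)
    · obtain rfl := eq_of_converges_subseq hx hsn hxsub strictMono_id hconv
      exact hno (hKsub z w hz hbdd hsame)
    · exact hne ((eq_of_converges_subseq hx hsn hxsub hk₁ h₁).trans
        (eq_of_converges_subseq hx hsn hxsub hk₂ h₂).symm)
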